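/- Let $p$ be a prime and let $d \ge 3$, $e \ge 5$, $k \ge 1$, $n \ge 4$ be integers. Let $R$ be the Galois ring $R_{e,k} \cong (\mathbb{Z}/p^e\mathbb{Z})[x]/(f)$, where $f$ is monic of degree $k$ and irreducible modulo $p$. For $x, y \in R^d$ write $x \cdot y = \sum_{i=1}^d x_i y_i$. Let $E \subset R^d$ and $\alpha_1,\dots,\alpha_n \in R$. A star in $E$ is a tuple $(c,x_1,\dots,x_n) \in E^{n+1}$ of distinct points such that $c\cdot x_j = \alpha_j$ for every $1 \le j \le n$. If $$|E| > \sqrt{14e}\; n\, p^{\,dek - dk/2 + nek/2 + n/2 - ek/2 + 3k/2},$$ then $$\bigl|\{(c,x_1,\dots,x_n)\in E^{n+1} : c\cdot x_j = \alpha_j \text{ for all } 1\le j\le n\}\bigr| \le \frac{2|E|^{n+1}}{p^{nek}},$$ and in particular the number of stars in $E$ is at most $2|E|^{n+1}/p^{nek}$. -/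

import Mathlib

open Polynomial Matrix

/-- `R` is (a copy of) the Galois ring `R_{e,k}` of characteristic `p ^ e` and residue degree `k`,
i.e. `R ≅ (ℤ/p^e)[x]/(f)` with `f` monic of degree `k` and irreducible modulo `p`.
(Every monic polynomial over `ℤ/p^e` lifts to a monic integer polynomial of the same degree, so
it is harmless to take `f` with integer coefficients and to reduce it modulo `p` and `p ^ e`.) -/
def IsGaloisRing (p e k : ℕ) (R : Type*) [CommRing R] : Prop :=
  ∃ f : ℤ[X], f.Monic ∧ f.natDegree = k ∧
    Irreducible (f.map (Int.castRingHom (ZMod p))) ∧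
    Nonempty (R ≃+* AdjoinRoot (f.map (Int.castRingHom (ZMod (p ^ e)))))

/-- The star-graph configurations in `E`: all `(n + 1)`-tuples `x = (c, x₁, …, xₙ)` of elements
of `E` (with `c = x 0`) satisfying `c ⬝ xⱼ = αⱼ` for every edge of the star. Repeated points
are allowed. -/
def starConfigurations {R : Type*} [CommRing R] {d n : ℕ} (E : Finset (Fin d → R))
    (α : Fin n → R) : Set (Fin (n + 1) → Fin d → R) :=
  {x | (∀ i, x i ∈ E) ∧ ∀ j : Fin n, x 0 ⬝ᵥ x j.succ = α j}

/-- The stars in `E`: those star-graph configurations whose `n + 1` points are distinct. -/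
def stars {R : Type*} [CommRing R] {d n : ℕ} (E : Finset (Fin d → R))
    (α : Fin n → R) : Set (Fin (n + 1) → Fin d → R) :=
  {x | x ∈ starConfigurations E α ∧ Function.Injective x}

/-! Write Q = |R| = q^e with q = p^k, and N_j(c) = #{x ∈ E : c·x = α_j}. The configuration count is
the sum over c ∈ E of ∏_j N_j(c), and on average N_j(c) should be |E|/Q. Expanding the condition c·x
= α_j in additive characters, then using Cauchy–Schwarz and orthogonality over all c ∈ R^d, bounds
the second moment of Q·N_j(c) − |E| by Q^(d+1)·|E| times the sum of |Ann(s)|^d over s ≠ 0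
(`sum_sq_deviation_le`). Since every nonzero s is p^v times a unit, that sum is at most
e·q^(1+(e−1)d) (`sum_card_annihilator_pow_le`). For each c, either every N_j(c) is at most (1 +
1/(2n))|E|/Q, or the largest one deviates from |E|/Q by a fixed proportion of itself, and the
squared deviation pays for the product (`prod_le_pow_add_sum_sq_deviation`). The first case
contributes at most 1.65·|E|^(n+1)/Q^n, and the threshold on |E| keeps the second below
0.35·|E|^(n+1)/Q^n. -/

/-- The properties of a Galois ring of characteristic `p ^ e` with residue field of size `q` used
in the Fourier-analytic estimates: it is a finite local ring with maximal ideal `(p)`. -/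
structure IsFiniteChainRing (p e q : ℕ) (R : Type*) [CommRing R] : Prop where
  pow_eq_zero : (p : R) ^ e = 0
  isUnit_or_dvd : ∀ r : R, IsUnit r ∨ (p : R) ∣ r
  card_eq : Nat.card R = q ^ e
  card_annihilator_le : ∀ v, Nat.card {r : R // (p : R) ^ v * r = 0} ≤ q ^ v

/-! ### Galois rings are finite chain rings -/

theorem ZMod.card_nsmul_eq_zero_le (m n : ℕ) [NeZero m] (hn : 0 < n) :
    Nat.card {z : ZMod m // n • z = 0} ≤ n := by
  classical
  rw [Nat.card_eq_fintype_card, Fintype.card_subtype]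
  exact IsAddCyclic.card_nsmul_eq_zero_le hn

theorem AdjoinRoot.card_of_monic {m : ℕ} {g : (ZMod m)[X]} (hg : g.Monic) :
    Nat.card (AdjoinRoot g) = m ^ g.natDegree := by
  rw [Nat.card_congr (AdjoinRoot.powerBasisAux' hg).equivFun.toEquiv, Nat.card_fun]
  simp

theorem AdjoinRoot.card_nsmul_eq_zero_le {m : ℕ} [NeZero m] {g : (ZMod m)[X]} (hg : g.Monic)
    {n : ℕ} (hn : 0 < n) :
    Nat.card {z : AdjoinRoot g // n • z = 0} ≤ n ^ g.natDegree := by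
  let b := (AdjoinRoot.powerBasisAux' hg).equivFun
  let F : {z : AdjoinRoot g // n • z = 0} → (Fin g.natDegree → {z : ZMod m // n • z = 0}) :=
    fun z i => ⟨b z.1 i, by
      have h : b (n • z.1) i = 0 := by rw [z.2]; simp
      rwa [map_nsmul] at h⟩
  have hF : Function.Injective F := by
    intro x y hxy
    apply Subtype.ext
    apply b.injective
    funext i
    exact congrArg Subtype.val (congrFun hxy i)
  refine (Nat.card_le_card_of_injective F hF).trans ?_
  rw [Nat.card_fun]
  simpa using Nat.pow_le_pow_left (ZMod.card_nsmul_eq_zero_le m n hn) g.natDegree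

theorem AdjoinRoot.natCast_self_eq_zero {m : ℕ} (g : (ZMod m)[X]) :
    (m : AdjoinRoot g) = 0 := by
  rw [← map_natCast (AdjoinRoot.of g), ZMod.natCast_self, map_zero]

/-- Lift r to u ∈ ℤ[X] and reduce modulo p. If f divides u there, r is a multiple of p. Otherwise a
Bézout identity modulo p makes some multiple of r equal to 1 − pt, a unit because p is nilpotent. -/
theorem AdjoinRoot.isUnit_or_natCast_dvd {p e : ℕ} {f : ℤ[X]}
    (hf : Irreducible (f.map (Int.castRingHom (ZMod p)))) (hp : p.Prime)
    (r : AdjoinRoot (f.map (Int.castRingHom (ZMod (p ^ e))))) :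
    IsUnit r ∨ ((p : ℕ) : AdjoinRoot (f.map (Int.castRingHom (ZMod (p ^ e))))) ∣ r := by
  have := Fact.mk hp
  revert r
  set g := f.map (Int.castRingHom (ZMod (p ^ e)))
  intro r
  let φ : ℤ[X] →+* AdjoinRoot g :=
    (AdjoinRoot.mk g).comp (Polynomial.mapRingHom (Int.castRingHom (ZMod (p ^ e))))
  have hφf : φ f = 0 := AdjoinRoot.mk_self
  have hφp : φ (C (p : ℤ)) = (p : AdjoinRoot g) := by simp
  have hnil : (p : AdjoinRoot g) ^ e = 0 := by
    exact_mod_cast AdjoinRoot.natCast_self_eq_zero g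
  have hφ : Function.Surjective φ :=
    AdjoinRoot.mk_surjective.comp
      (Polynomial.map_surjective _ (ZMod.ringHom_surjective (Int.castRingHom (ZMod (p ^ e)))))
  have hsurj := Polynomial.map_surjective _ (ZMod.ringHom_surjective (Int.castRingHom (ZMod p)))
  have hker : ∀ u : ℤ[X], u.map (Int.castRingHom (ZMod p)) = 0 → (p : AdjoinRoot g) ∣ φ u := by
    intro u hu
    have : C (p : ℤ) ∣ u := by
      rw [C_dvd_iff_dvd_coeff]
      intro i
      have := congrArg (fun w => w.coeff i) hu
      simpa [ZMod.intCast_zmod_eq_zero_iff_dvd] using this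
    rw [← hφp]
    exact map_dvd φ this
  obtain ⟨u, hur⟩ := hφ r
  rw [← hur]
  by_cases hdvd : f.map (Int.castRingHom (ZMod p)) ∣ u.map (Int.castRingHom (ZMod p))
  · right
    obtain ⟨w, hw⟩ := hdvd
    obtain ⟨w, rfl⟩ := hsurj w
    have := hker (u - f * w) (by simp [hw])
    simpa [hφf] using this
  · left
    obtain ⟨a, b, hab⟩ := hf.coprime_iff_not_dvd.2 hdvd
    obtain ⟨a, rfl⟩ := hsurj a
    obtain ⟨b, rfl⟩ := hsurj b
    obtain ⟨t, ht⟩ := hker (1 - (a * f + b * u)) (by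
      rw [Polynomial.map_sub, Polynomial.map_add, Polynomial.map_mul, Polynomial.map_mul, hab]
      simp)
    have hu : φ b * φ u = 1 + -(p * t) := by
      rw [← ht]; simp [hφf]
    have : IsUnit (φ b * φ u) := by
      rw [hu]
      apply IsNilpotent.isUnit_one_add
      exact ⟨e, by rw [neg_pow, mul_pow, hnil]; simp⟩
    exact isUnit_of_mul_isUnit_right this

theorem IsFiniteChainRing.of_ringEquiv {p e q : ℕ} {R S : Type*} [CommRing R] [CommRing S]
    (φ : R ≃+* S) (h : IsFiniteChainRing p e q S) : IsFiniteChainRing p e q R where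
  pow_eq_zero := φ.injective (by simpa using h.pow_eq_zero)
  isUnit_or_dvd r := by
    refine (h.isUnit_or_dvd (φ r)).imp (fun hu => ?_) fun hd => ?_
    · simpa using hu.map φ.symm
    · simpa using map_dvd φ.symm hd
  card_eq := (Nat.card_congr φ.toEquiv).trans h.card_eq
  card_annihilator_le v := by
    refine le_trans (le_of_eq (Nat.card_congr (φ.toEquiv.subtypeEquiv fun r => ?_)))
      (h.card_annihilator_le v)
    rw [← φ.map_eq_zero_iff]
    simp

theorem IsGaloisRing.isFiniteChainRing {p e k : ℕ} {R : Type*} [CommRing R] (hp : p.Prime)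
    (he : e ≠ 0) (hR : IsGaloisRing p e k R) : IsFiniteChainRing p e (p ^ k) R := by
  obtain ⟨f, hm, hdeg, hirr, ⟨φ⟩⟩ := hR
  refine IsFiniteChainRing.of_ringEquiv φ ?_
  have : Fact (1 < p ^ e) := ⟨Nat.one_lt_pow he hp.one_lt⟩
  have : NeZero (p ^ e) := ⟨(pow_pos hp.pos e).ne'⟩
  have hgm := hm.map (Int.castRingHom (ZMod (p ^ e)))
  have hgd : (f.map (Int.castRingHom (ZMod (p ^ e)))).natDegree = k := by
    rw [hm.natDegree_map, hdeg]
  refine ⟨?_, AdjoinRoot.isUnit_or_natCast_dvd hirr hp, ?_, fun v => ?_⟩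
  · exact_mod_cast AdjoinRoot.natCast_self_eq_zero (f.map (Int.castRingHom (ZMod (p ^ e))))
  · rw [AdjoinRoot.card_of_monic hgm, hgd, ← pow_mul, ← pow_mul, mul_comm]
  · have h := AdjoinRoot.card_nsmul_eq_zero_le hgm (pow_pos hp.pos v)
    rw [hgd, ← pow_mul, mul_comm, pow_mul] at h
    simpa [nsmul_eq_mul] using h

/-! ### Annihilators and characters of a finite chain ring -/

theorem Finset.sum_biUnion_le_sum_sum {ι κ : Type*} [DecidableEq κ] (s : Finset ι)
    (t : ι → Finset κ) (f : κ → ℕ) : ∑ x ∈ s.biUnion t, f x ≤ ∑ i ∈ s, ∑ x ∈ t i, f x := by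
  classical
  induction s using Finset.induction_on with
  | empty => simp
  | insert a s ha ih =>
    rw [Finset.biUnion_insert, Finset.sum_insert ha]
    have := Finset.sum_union_inter (s₁ := t a) (s₂ := s.biUnion t) (f := f)
    omega

namespace IsFiniteChainRing

variable {p e q : ℕ} {R : Type*} [CommRing R]

theorem exists_eq_pow_mul_unit (h : IsFiniteChainRing p e q R) {s : R} (hs : s ≠ 0) :
    ∃ v < e, ∃ u : Rˣ, s = (p : R) ^ v * u := by
  have hlt : ∀ v, (p : R) ^ v ∣ s → v < e := by
    intro v hv
    by_contra! hev
    exact hs (zero_dvd_iff.1 (h.pow_eq_zero ▸ (pow_dvd_pow _ hev).trans hv))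
  classical
  let v := Nat.findGreatest (fun v => (p : R) ^ v ∣ s) e
  have hv : (p : R) ^ v ∣ s :=
    Nat.findGreatest_spec (P := fun v => (p : R) ^ v ∣ s) (Nat.zero_le e) (by simp)
  obtain ⟨t, ht⟩ := hv
  refine ⟨v, hlt v ⟨t, ht⟩, ?_⟩
  rcases h.isUnit_or_dvd t with hu | ⟨w, rfl⟩
  · exact ⟨hu.unit, ht⟩
  · exfalso
    have h1 : (p : R) ^ (v + 1) ∣ s := ⟨w, by rw [ht, pow_succ, mul_assoc]⟩
    have := Nat.le_findGreatest (P := fun v => (p : R) ^ v ∣ s) (hlt _ h1).le h1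
    exact absurd this (by simp [v])

/-- Otherwise p^(e−1) would annihilate all q^e elements, but its annihilator has at most q^(e−1). -/
theorem pow_pred_ne_zero (h : IsFiniteChainRing p e q R) (hq : 1 < q) (he : e ≠ 0) :
    (p : R) ^ (e - 1) ≠ 0 := by
  intro h0
  have h1 := h.card_annihilator_le (e - 1)
  rw [Nat.card_congr (Equiv.subtypeUnivEquiv fun r => by rw [h0, zero_mul]), h.card_eq] at h1
  exact absurd ((Nat.pow_le_pow_iff_right hq).1 h1) (by omega)

theorem finite (h : IsFiniteChainRing p e q R) (hq : 1 < q) : Finite R :=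
  Nat.finite_of_card_ne_zero (by rw [h.card_eq]; positivity)

/-- Every nonzero ideal contains p^(e−1), so a character nontrivial at that one element is
nontrivial on every nonzero ideal. -/
theorem exists_isPrimitive (h : IsFiniteChainRing p e q R) (hq : 1 < q) (he : e ≠ 0) :
    ∃ ψ : AddChar R ℂ, ψ.IsPrimitive := by
  have := h.finite hq
  obtain ⟨ψ, hψ⟩ := AddChar.exists_apply_ne_zero.2 (h.pow_pred_ne_zero hq he)
  refine ⟨ψ, fun a ha h1 => hψ ?_⟩
  obtain ⟨v, hv, u, rfl⟩ := h.exists_eq_pow_mul_unit ha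
  have := DFunLike.congr_fun h1 ((p : R) ^ (e - 1 - v) * ↑u⁻¹)
  rw [AddChar.mulShift_apply, AddChar.one_apply] at this
  rw [← this]
  congr 1
  calc (p : R) ^ (e - 1) = (p : R) ^ v * (p : R) ^ (e - 1 - v) := by
        rw [← pow_add]; congr 1; omega
    _ = (p : R) ^ v * u * ((p : R) ^ (e - 1 - v) * ↑u⁻¹) := by
        linear_combination (-((p : R) ^ v * (p : R) ^ (e - 1 - v))) * u.mul_inv

/-- The layer of elements p^v·u has at most q^(e−v) members, each with annihilator of size at most
q^v. The exponent e − v + vd is nondecreasing in v because d ≥ 1, so each of the e layers is bounded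
by the value at v = e − 1. -/
theorem sum_card_annihilator_pow_le [Fintype R] [DecidableEq R] (h : IsFiniteChainRing p e q R)
    (hq : 1 < q) {d : ℕ} (hd : 1 ≤ d) :
    ∑ s : R with s ≠ 0, (Finset.univ.filter fun r : R => s * r = 0).card ^ d
      ≤ e * q ^ (1 + (e - 1) * d) := by
  let S : ℕ → Finset R := fun v => Finset.univ.filter fun s => ∃ u : Rˣ, s = (p : R) ^ v * u
  have hann : ∀ v, (Finset.univ.filter fun r : R => (p : R) ^ v * r = 0).card ≤ q ^ v := by
    intro v
    have := h.card_annihilator_le v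
    rwa [Nat.card_eq_fintype_card, Fintype.card_subtype] at this
  have hS : ∀ v < e, (S v).card ≤ q ^ (e - v) := by
    intro v hv
    -- Layer v is killed by p^(e−v), so the annihilator bound also counts the layer.
    refine le_trans (Finset.card_le_card fun s hs => ?_) (hann (e - v))
    obtain ⟨u, rfl⟩ := (Finset.mem_filter.1 hs).2
    simp only [Finset.mem_filter, Finset.mem_univ, true_and]
    rw [← mul_assoc, ← pow_add, Nat.sub_add_cancel hv.le, h.pow_eq_zero, zero_mul]
  have hsub : (Finset.univ.filter fun s : R => s ≠ 0) ⊆ (Finset.range e).biUnion S := by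
    intro s hs
    obtain ⟨v, hv, u, hu⟩ := h.exists_eq_pow_mul_unit (Finset.mem_filter.1 hs).2
    exact Finset.mem_biUnion.2 ⟨v, Finset.mem_range.2 hv, by simp [S]; exact ⟨u, hu⟩⟩
  have hterm : ∀ v, ∀ s ∈ S v,
      (Finset.univ.filter fun r : R => s * r = 0).card ^ d ≤ (q ^ v) ^ d := by
    intro v s hs
    obtain ⟨u, rfl⟩ := (Finset.mem_filter.1 hs).2
    refine Nat.pow_le_pow_left (le_trans (Finset.card_le_card fun r hr => ?_) (hann v)) d
    simp only [Finset.mem_filter, Finset.mem_univ, true_and] at hr ⊢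
    rw [mul_right_comm] at hr
    exact (Units.mul_left_eq_zero u).1 hr
  calc _ ≤ ∑ s ∈ (Finset.range e).biUnion S,
          (Finset.univ.filter fun r : R => s * r = 0).card ^ d :=
        Finset.sum_le_sum_of_subset hsub
    _ ≤ ∑ v ∈ Finset.range e, ∑ s ∈ S v,
          (Finset.univ.filter fun r : R => s * r = 0).card ^ d := Finset.sum_biUnion_le_sum_sum _ _ _
    _ ≤ ∑ v ∈ Finset.range e, q ^ (1 + (e - 1) * d) := by
        refine Finset.sum_le_sum fun v hv => ?_
        have hve := Finset.mem_range.1 hv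
        refine (Finset.sum_le_card_nsmul _ _ _ (hterm v)).trans ?_
        rw [smul_eq_mul, ← pow_mul]
        refine (Nat.mul_le_mul_right _ (hS v hve)).trans ?_
        rw [← pow_add]
        refine Nat.pow_le_pow_right (by omega) ?_
        obtain ⟨m, rfl⟩ : ∃ m, e = v + 1 + m := ⟨e - (v + 1), by omega⟩
        have h1 : v + 1 + m - v = 1 + m := by omega
        have h2 : v + 1 + m - 1 = v + m := by omega
        rw [h1, h2]
        nlinarith [Nat.mul_le_mul_left m hd]
    _ = _ := by simp

end IsFiniteChainRing

/-! ### Second moment of the hyperplane counts -/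

theorem AddChar.map_finsetSum_eq_prod {A M ι : Type*} [AddCommMonoid A] [CommMonoid M]
    (ψ : AddChar A M) (s : Finset ι) (f : ι → A) : ψ (∑ i ∈ s, f i) = ∏ i ∈ s, ψ (f i) := by
  classical
  induction s using Finset.induction_on with
  | empty => simp
  | insert a s ha ih => rw [Finset.sum_insert ha, Finset.prod_insert ha, map_add_eq_mul, ih]

namespace AddChar.IsPrimitive

variable {R : Type*} [CommRing R] [Fintype R] [DecidableEq R] {d : ℕ} {ψ : AddChar R ℂ}

theorem sum_dotProduct (hψ : ψ.IsPrimitive) (z : Fin d → R) :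
    ∑ c : Fin d → R, ψ (c ⬝ᵥ z) = if z = 0 then (Fintype.card R : ℂ) ^ d else 0 := by
  have h1 : ∀ c : Fin d → R, ψ (c ⬝ᵥ z) = ∏ i, ψ (c i * z i) := fun c =>
    AddChar.map_finsetSum_eq_prod ψ _ _
  simp_rw [h1]
  rw [← Fintype.piFinset_univ, ← Finset.prod_univ_sum (fun _ => Finset.univ)
    (fun i r => ψ (r * z i))]
  simp_rw [AddChar.sum_mulShift _ hψ]
  split_ifs with hz
  · simp [hz]
  · obtain ⟨i, hi⟩ := Function.ne_iff.1 hz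
    exact Finset.prod_eq_zero (Finset.mem_univ i) (by simpa using hi)

theorem card_smul_eq_zero_le (s : R) :
    (Finset.univ.filter fun z : Fin d → R => s • z = 0).card
      ≤ (Finset.univ.filter fun r : R => s * r = 0).card ^ d := by
  calc _ ≤ (Fintype.piFinset fun _ : Fin d => Finset.univ.filter fun r : R => s * r = 0).card := by
        refine Finset.card_le_card fun z hz => Fintype.mem_piFinset.2 fun i => ?_
        simpa using congrFun (Finset.mem_filter.1 hz).2 i
    _ = _ := by simp

/-- After expanding the square, orthogonality in c keeps only the pairs with s(x − y) = 0; for fixed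
x, the differences x − y lie in Ann(s)^d. -/
theorem sum_norm_sq_le (hψ : ψ.IsPrimitive) (E : Finset (Fin d → R)) (s : R) :
    ∑ c : Fin d → R, ‖∑ x ∈ E, ψ (s * (c ⬝ᵥ x))‖ ^ 2
      ≤ (Fintype.card R : ℝ) ^ d * E.card
        * ((Finset.univ.filter fun r : R => s * r = 0).card : ℝ) ^ d := by
  have key : ((∑ c : Fin d → R, ‖∑ x ∈ E, ψ (s * (c ⬝ᵥ x))‖ ^ 2 : ℝ) : ℂ)
      = ((∑ x ∈ E, ∑ y ∈ E, if s • (x - y) = 0 then (Fintype.card R : ℝ) ^ d else 0 : ℝ) : ℂ) := by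
    push_cast
    have h1 : ∀ c : Fin d → R, (‖∑ x ∈ E, ψ (s * (c ⬝ᵥ x))‖ : ℂ) ^ 2
        = ∑ x ∈ E, ∑ y ∈ E, ψ (c ⬝ᵥ (s • (x - y))) := by
      intro c
      rw [← Complex.mul_conj', map_sum, Finset.sum_mul_sum]
      refine Finset.sum_congr rfl fun x _ => Finset.sum_congr rfl fun y _ => ?_
      rw [← AddChar.map_neg_eq_conj, ← AddChar.map_add_eq_mul, dotProduct_smul, dotProduct_sub,
        smul_eq_mul]
      congr 1
      ring
    simp_rw [h1]
    rw [Finset.sum_comm]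
    refine Finset.sum_congr rfl fun x _ => ?_
    rw [Finset.sum_comm]
    refine Finset.sum_congr rfl fun y _ => ?_
    rw [hψ.sum_dotProduct]
    split_ifs <;> simp
  rw [Complex.ofReal_inj.1 key]
  have hx : ∀ x ∈ E, (∑ y ∈ E, if s • (x - y) = 0 then (Fintype.card R : ℝ) ^ d else 0)
      ≤ (Fintype.card R : ℝ) ^ d
        * ((Finset.univ.filter fun r : R => s * r = 0).card : ℝ) ^ d := by
    intro x _
    rw [← Finset.sum_filter, Finset.sum_const, nsmul_eq_mul, mul_comm]
    refine mul_le_mul_of_nonneg_left ?_ (by positivity)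
    rw [← Nat.cast_pow]
    refine Nat.cast_le.2 (le_trans ?_ (card_smul_eq_zero_le (d := d) s))
    refine (Finset.card_le_card_of_injOn (fun y => x - y) ?_ ?_)
    · intro y hy
      simpa using (Finset.mem_filter.1 hy).2
    · intro y _ z _ hyz
      exact sub_right_injective hyz
  refine (Finset.sum_le_sum hx).trans (le_of_eq ?_)
  rw [Finset.sum_const, nsmul_eq_mul]
  ring

/-- The subtracted |E| is exactly the term s = 0 of the character expansion. -/
theorem card_mul_deviation (hψ : ψ.IsPrimitive) (E : Finset (Fin d → R)) (a : R)
    (c : Fin d → R) :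
    (Fintype.card R : ℂ) * (E.filter fun x => c ⬝ᵥ x = a).card - E.card
      = ∑ s : R with s ≠ 0, ψ (-(s * a)) * ∑ x ∈ E, ψ (s * (c ⬝ᵥ x)) := by
  have h1 : (Fintype.card R : ℂ) * (E.filter fun x => c ⬝ᵥ x = a).card
      = ∑ s : R, ψ (-(s * a)) * ∑ x ∈ E, ψ (s * (c ⬝ᵥ x)) := by
    simp_rw [Finset.mul_sum]
    rw [Finset.sum_comm]
    have h2 : ∀ x : Fin d → R, ∑ s : R, ψ (-(s * a)) * ψ (s * (c ⬝ᵥ x))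
        = if c ⬝ᵥ x = a then (Fintype.card R : ℂ) else 0 := by
      intro x
      have h3 := AddChar.sum_mulShift (c ⬝ᵥ x - a) hψ
      simp only [sub_eq_zero] at h3
      rw [apply_ite Nat.cast, Nat.cast_zero] at h3
      rw [← h3]
      refine Finset.sum_congr rfl fun s _ => ?_
      rw [← AddChar.map_add_eq_mul]
      congr 1
      ring
    simp_rw [h2]
    rw [← Finset.sum_filter, Finset.sum_const, nsmul_eq_mul, mul_comm]
  rw [h1, Finset.filter_ne' Finset.univ (0 : R), ← Finset.sum_erase_add _ _ (Finset.mem_univ (0 : R))]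
  simp

theorem sum_sq_deviation_le (hψ : ψ.IsPrimitive) (E : Finset (Fin d → R)) (a : R) :
    ∑ c : Fin d → R, ((Fintype.card R : ℝ) * (E.filter fun x => c ⬝ᵥ x = a).card - E.card) ^ 2
      ≤ (Fintype.card R : ℝ) ^ (d + 1) * E.card *
        ∑ s : R with s ≠ 0, ((Finset.univ.filter fun r : R => s * r = 0).card : ℝ) ^ d := by
  have hc : ∀ c : Fin d → R,
      ((Fintype.card R : ℝ) * (E.filter fun x => c ⬝ᵥ x = a).card - E.card) ^ 2
        ≤ (Fintype.card R : ℝ) * ∑ s : R with s ≠ 0, ‖∑ x ∈ E, ψ (s * (c ⬝ᵥ x))‖ ^ 2 := by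
    intro c
    have h1 : |(Fintype.card R : ℝ) * (E.filter fun x => c ⬝ᵥ x = a).card - E.card|
        ≤ ∑ s : R with s ≠ 0, ‖∑ x ∈ E, ψ (s * (c ⬝ᵥ x))‖ := by
      have h2 := congrArg norm (hψ.card_mul_deviation E a c)
      have h3 : ‖(Fintype.card R : ℂ) * (E.filter fun x => c ⬝ᵥ x = a).card - E.card‖
          = |(Fintype.card R : ℝ) * (E.filter fun x => c ⬝ᵥ x = a).card - E.card| := by
        rw [← Real.norm_eq_abs, ← Complex.norm_real]
        push_cast
        rfl
      rw [← h3, h2]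
      refine (norm_sum_le _ _).trans (le_of_eq ?_)
      refine Finset.sum_congr rfl fun s _ => ?_
      rw [norm_mul, AddChar.norm_apply, one_mul]
    rw [← sq_abs]
    -- Cauchy–Schwarz over s costs one factor |R|, whence the exponent d + 1.
    refine (pow_le_pow_left₀ (abs_nonneg _) h1 2).trans (sq_sum_le_card_mul_sum_sq.trans ?_)
    refine mul_le_mul_of_nonneg_right ?_ (by positivity)
    exact_mod_cast Finset.card_le_univ _
  refine (Finset.sum_le_sum fun c _ => hc c).trans ?_
  rw [← Finset.mul_sum, Finset.sum_comm, pow_succ', mul_assoc, mul_assoc]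
  refine mul_le_mul_of_nonneg_left ?_ (by positivity)
  rw [Finset.mul_sum, Finset.mul_sum]
  refine Finset.sum_le_sum fun s _ => ?_
  rw [← mul_assoc]
  exact hψ.sum_norm_sq_le E s

end AddChar.IsPrimitive

/-! ### From second moments to the configuration count -/

theorem ncard_starConfigurations_le {R : Type*} [CommRing R] [DecidableEq R] {d n : ℕ}
    (E : Finset (Fin d → R)) (α : Fin n → R) :
    (starConfigurations E α).ncard
      ≤ ∑ c ∈ E, ∏ j, (E.filter fun x => c ⬝ᵥ x = α j).card := by
  let S : Finset (Fin (n + 1) → Fin d → R) := E.biUnion fun c =>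
    (Fintype.piFinset fun j => E.filter fun x => c ⬝ᵥ x = α j).image
      fun y => (Fin.cons c y : Fin (n + 1) → Fin d → R)
  have hS : starConfigurations E α ⊆ (S : Set (Fin (n + 1) → Fin d → R)) := by
    rintro x ⟨hx, hα⟩
    refine Finset.mem_coe.2 (Finset.mem_biUnion.2 ⟨x 0, hx 0, Finset.mem_image.2
      ⟨Fin.tail x, Fintype.mem_piFinset.2 fun j => ?_, Fin.cons_self_tail x⟩⟩)
    exact Finset.mem_filter.2 ⟨hx _, hα j⟩
  refine (Set.ncard_le_ncard hS S.finite_toSet).trans ?_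
  rw [Set.ncard_coe_finset]
  refine Finset.card_biUnion_le.trans (Finset.sum_le_sum fun c _ => ?_)
  exact Finset.card_image_le.trans (Fintype.card_piFinset _).le

theorem starConfigurations_finite {R : Type*} [CommRing R] {d n : ℕ}
    (E : Finset (Fin d → R)) (α : Fin n → R) : (starConfigurations E α).Finite :=
  (Set.Finite.pi' fun _ => E.finite_toSet).subset fun _ hx => hx.1

/-- A product of `n` numbers in `[0, X]` is at most about `m ^ n`, up to an error controlled by
the squared deviations from `m`. -/
theorem prod_le_pow_add_sum_sq_deviation {n : ℕ} (hn : 2 ≤ n) {f : Fin n → ℝ} {X m : ℝ}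
    (hf : ∀ j, 0 ≤ f j) (hX : ∀ j, f j ≤ X) (hm : 0 ≤ m) :
    ∏ j, f j ≤ ((1 + 1 / (2 * n)) * m) ^ n
      + ∑ j, (2 * n + 1) ^ 2 * X ^ (n - 2) * (f j - m) ^ 2 := by
  have hn0 : (0 : ℝ) < n := by positivity
  have : Nonempty (Fin n) := ⟨⟨0, by omega⟩⟩
  obtain ⟨i, hi⟩ := Finite.exists_max f
  have hX0 : 0 ≤ X := (hf i).trans (hX i)
  have hprod : ∏ j, f j ≤ f i ^ n := by
    simpa using Finset.prod_le_prod (s := Finset.univ) (fun j _ => hf j) (fun j _ => hi j)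
  refine hprod.trans ?_
  have hnn : ∀ j, 0 ≤ (2 * (n : ℝ) + 1) ^ 2 * X ^ (n - 2) * (f j - m) ^ 2 := fun j => by
    positivity
  by_cases hfi : f i ≤ (1 + 1 / (2 * n)) * m
  · exact (pow_le_pow_left₀ (hf i) hfi n).trans
      (le_add_of_nonneg_right (Finset.sum_nonneg fun j _ => hnn j))
  -- Here m < 2n/(2n+1) · f i, so f i − m exceeds f i/(2n+1). Two factors of f i ^ n are traded for
  -- this deviation and the rest are bounded by X.
  · have hdev : f i ≤ (2 * n + 1) * (f i - m) := by
      have h1 : (2 * n) * ((1 + 1 / (2 * n)) * m) = (2 * n + 1) * m := by field_simp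
      nlinarith [mul_le_mul_of_nonneg_left (not_le.1 hfi).le (by positivity : (0 : ℝ) ≤ 2 * n)]
    have h2 : f i ^ n ≤ (2 * n + 1) ^ 2 * X ^ (n - 2) * (f i - m) ^ 2 := by
      calc f i ^ n = f i ^ 2 * f i ^ (n - 2) := by rw [← pow_add]; congr 1; omega
        _ ≤ ((2 * n + 1) * (f i - m)) ^ 2 * X ^ (n - 2) := by
            have := hf i
            have := hX i
            gcongr
        _ = _ := by ring
    refine h2.trans ((Finset.single_le_sum (fun j _ => hnn j) (Finset.mem_univ i)).trans ?_)
    exact le_add_of_nonneg_left (by positivity)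

theorem one_add_one_div_two_mul_pow_le (n : ℕ) : (1 + 1 / (2 * n) : ℝ) ^ n ≤ 1.65 := by
  rcases Nat.eq_zero_or_pos n with rfl | hn
  · norm_num
  have hn0 : (0 : ℝ) < n := by positivity
  have h1 : (1 + 1 / (2 * n) : ℝ) ^ n ≤ Real.exp (1 / 2) := by
    calc (1 + 1 / (2 * n) : ℝ) ^ n ≤ Real.exp (1 / (2 * n)) ^ n := by
          refine pow_le_pow_left₀ (by positivity) ?_ n
          rw [add_comm]
          exact Real.add_one_le_exp _
      _ = Real.exp (1 / 2) := by
          rw [← Real.exp_nat_mul]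
          congr 1
          field_simp
  have h2 : Real.exp (1 / 2) ^ 2 = Real.exp 1 := by
    rw [← Real.exp_nat_mul]
    norm_num
  have h3 := Real.exp_one_lt_d9
  -- 1.65² = 2.7225 exceeds Euler's number.
  nlinarith [Real.exp_pos (1 / 2)]

theorem IsFiniteChainRing.ncard_starConfigurations_le {R : Type*} [CommRing R] {p e q d n : ℕ}
    (h : IsFiniteChainRing p e q R) (hq : 1 < q) (he : 1 ≤ e) (hd : 1 ≤ d) (hn : 2 ≤ n)
    (E : Finset (Fin d → R)) (α : Fin n → R) :
    ((starConfigurations E α).ncard : ℝ) ≤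
      E.card * ((1 + 1 / (2 * n)) * (E.card / (q : ℝ) ^ e)) ^ n
      + n * ((2 * n + 1) ^ 2 * (E.card : ℝ) ^ (n - 1) * ((q : ℝ) ^ e) ^ (d - 1)
        * (e * q ^ (1 + (e - 1) * d))) := by
  classical
  have := h.finite hq
  have := Fintype.ofFinite R
  obtain ⟨ψ, hψ⟩ := h.exists_isPrimitive hq (by omega)
  have hQ : Fintype.card R = q ^ e := by rw [← Nat.card_eq_fintype_card, h.card_eq]
  have hq0 : (0 : ℝ) < q := by positivity
  set Q : ℝ := (q : ℝ) ^ e with hQdef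
  have hQ0 : 0 < Q := by positivity
  set X : ℝ := (E.card : ℝ) with hXdef
  let f : (Fin d → R) → Fin n → ℝ := fun c j => (E.filter fun x => c ⬝ᵥ x = α j).card
  have hdev : ∀ j, ∑ c ∈ E, (f c j - X / Q) ^ 2 ≤
      X * Q ^ (d - 1) * (e * q ^ (1 + (e - 1) * d)) := by
    intro j
    have h1 := hψ.sum_sq_deviation_le E (α j)
    have h2 : ∑ s : R with s ≠ 0, ((Finset.univ.filter fun r : R => s * r = 0).card : ℝ) ^ d
        ≤ e * q ^ (1 + (e - 1) * d) := by
      exact_mod_cast h.sum_card_annihilator_pow_le hq hd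
    have hQ' : (Fintype.card R : ℝ) = Q := by rw [hQ]; push_cast; rfl
    rw [hQ'] at h1
    have h3 : ∀ c, (f c j - X / Q) ^ 2 = (Q * f c j - X) ^ 2 / Q ^ 2 := by
      intro c; field_simp
    -- Enlarging the range of c from E to R^d is what makes orthogonality available.
    calc ∑ c ∈ E, (f c j - X / Q) ^ 2 ≤ ∑ c, (f c j - X / Q) ^ 2 :=
          Finset.sum_le_univ_sum_of_nonneg fun c => sq_nonneg _
      _ = (∑ c, (Q * f c j - X) ^ 2) / Q ^ 2 := by
          simp_rw [h3]; rw [Finset.sum_div]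
      _ ≤ (Q ^ (d + 1) * X * (e * q ^ (1 + (e - 1) * d))) / Q ^ 2 := by
          refine div_le_div_of_nonneg_right (h1.trans ?_) (by positivity)
          exact mul_le_mul_of_nonneg_left h2 (by positivity)
      _ = _ := by
          obtain ⟨m, rfl⟩ : ∃ m, d = m + 1 := ⟨d - 1, by omega⟩
          rw [Nat.add_sub_cancel]
          field_simp
          ring
  calc ((starConfigurations E α).ncard : ℝ) ≤ ∑ c ∈ E, ∏ j, f c j := by
        have h1 := _root_.ncard_starConfigurations_le E α
        simp only [f]
        exact_mod_cast h1
    _ ≤ ∑ c ∈ E, (((1 + 1 / (2 * n)) * (X / Q)) ^ n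
          + ∑ j, (2 * n + 1) ^ 2 * X ^ (n - 2) * (f c j - X / Q) ^ 2) := by
        refine Finset.sum_le_sum fun c _ => prod_le_pow_add_sum_sq_deviation hn
          (fun j => Nat.cast_nonneg _) (fun j => ?_) (by positivity)
        exact Nat.cast_le.2 (Finset.card_filter_le _ _)
    _ = X * ((1 + 1 / (2 * n)) * (X / Q)) ^ n
          + ∑ j, (2 * n + 1) ^ 2 * X ^ (n - 2) * ∑ c ∈ E, (f c j - X / Q) ^ 2 := by
        rw [Finset.sum_add_distrib, Finset.sum_const, nsmul_eq_mul, Finset.sum_comm]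
        simp_rw [Finset.mul_sum]
        rfl
    _ ≤ X * ((1 + 1 / (2 * n)) * (X / Q)) ^ n
          + ∑ _j : Fin n, (2 * n + 1) ^ 2 * X ^ (n - 2) *
            (X * Q ^ (d - 1) * (e * q ^ (1 + (e - 1) * d))) := by
        gcongr with j
        exact hdev j
    _ = _ := by
        rw [Finset.sum_const, Finset.card_univ, Fintype.card_fin, nsmul_eq_mul]
        obtain ⟨m, rfl⟩ : ∃ m, n = m + 2 := ⟨n - 2, by omega⟩
        have h1 : m + 2 - 2 = m := by omega
        have h2 : m + 2 - 1 = m + 1 := by omega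
        rw [h1, h2]
        ring

/-! ### Numerical use of the threshold -/

/-- Squaring clears the halves in the exponent, and the factor q^(e+d) cancels its negative terms,
leaving natural powers only. -/
theorem sq_threshold_mul_eq {p e k d n : ℕ} (hp : p.Prime) :
    ((p : ℝ) ^ ((d : ℝ) * e * k - (d : ℝ) * k / 2 + (n : ℝ) * e * k / 2 + (n : ℝ) / 2
        - (e : ℝ) * k / 2 + 3 * (k : ℝ) / 2)) ^ 2 * ((p : ℝ) ^ k) ^ (e + d)
      = ((p : ℝ) ^ k) ^ (e * (2 * d + n) + 3) * (p : ℝ) ^ n := by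
  have hp0 : (0 : ℝ) < p := by exact_mod_cast hp.pos
  rw [← pow_mul, ← pow_mul, ← pow_add, ← Real.rpow_natCast _ 2, ← Real.rpow_mul hp0.le,
    ← Real.rpow_natCast, ← Real.rpow_natCast, ← Real.rpow_add hp0]
  congr 1
  push_cast
  ring

theorem star_error_le {p e k d n : ℕ} {X : ℝ} (hp : p.Prime) (he : 1 ≤ e) (hk : 1 ≤ k)
    (hd : 1 ≤ d) (hn : 4 ≤ n)
    (hX : X > √(14 * (e : ℝ)) * (n : ℝ) *
      (p : ℝ) ^ ((d : ℝ) * e * k - (d : ℝ) * k / 2 + (n : ℝ) * e * k / 2 + (n : ℝ) / 2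
        - (e : ℝ) * k / 2 + 3 * (k : ℝ) / 2)) :
    n * (2 * n + 1) ^ 2 * (((p : ℝ) ^ k) ^ e) ^ (n + d - 1)
      * (e * ((p : ℝ) ^ k) ^ (1 + (e - 1) * d)) ≤ 0.35 * X ^ 2 := by
  have hp2 : (2 : ℝ) ≤ p := by exact_mod_cast hp.two_le
  have hp0 : (0 : ℝ) < p := by linarith
  have hsq := pow_le_pow_left₀ (by positivity) hX.le 2
  rw [mul_pow, mul_pow, Real.sq_sqrt (by positivity)] at hsq
  have hthr := sq_threshold_mul_eq (e := e) (k := k) (d := d) (n := n) hp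
  generalize ((p : ℝ) ^ ((d : ℝ) * e * k - (d : ℝ) * k / 2 + (n : ℝ) * e * k / 2 + (n : ℝ) / 2
        - (e : ℝ) * k / 2 + 3 * (k : ℝ) / 2)) ^ 2 = Y at hsq hthr
  have hq2 : (2 : ℝ) ≤ (p : ℝ) ^ k := hp2.trans (le_self_pow₀ (by linarith) (by omega))
  generalize (p : ℝ) ^ k = q at hq2 hthr ⊢
  have hq0 : 0 < q := by linarith
  have hn4 : (4 : ℝ) ≤ n := by exact_mod_cast hn
  have hnp : (n : ℝ) ≤ (p : ℝ) ^ n :=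
    (by exact_mod_cast Nat.lt_two_pow_self.le : (n : ℝ) ≤ 2 ^ n).trans
      (pow_le_pow_left₀ (by norm_num) hp2 n)
  refine le_of_mul_le_mul_right ?_ (pow_pos hq0 (e + d))
  have hexp : (q ^ e) ^ (n + d - 1) * q ^ (1 + (e - 1) * d) * q ^ (e + d)
      = q ^ (e * (2 * d + n)) * q := by
    obtain ⟨a, rfl⟩ : ∃ a, d = a + 1 := ⟨d - 1, by omega⟩
    obtain ⟨b, rfl⟩ : ∃ b, e = b + 1 := ⟨e - 1, by omega⟩
    have h1 : n + (a + 1) - 1 = n + a := by omega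
    rw [h1, Nat.add_sub_cancel, ← pow_mul, ← pow_add, ← pow_add, ← pow_succ]
    congr 1
    ring
  -- Compared with the error term, the squared threshold has a surplus q²·p^n, which absorbs one
  -- factor n of n(2n+1)². The constant is 4.9 = 0.35 · 14.
  have hnum : (n : ℝ) * (2 * n + 1) ^ 2 ≤ 4.9 * (n ^ 2 * (q ^ 2 * (p : ℝ) ^ n)) := by
    -- n ≥ 4 gives 2n + 1 ≤ 2.25n, and 2.25² = 5.0625.
    have h1 : (2 * (n : ℝ) + 1) ^ 2 ≤ 5.0625 * n ^ 2 := by nlinarith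
    have h2 : 4 * (n : ℝ) ≤ q ^ 2 * (p : ℝ) ^ n :=
      mul_le_mul (by nlinarith) hnp (by positivity) (by positivity)
    nlinarith [mul_le_mul_of_nonneg_left h1 (by positivity : (0 : ℝ) ≤ n),
      mul_le_mul_of_nonneg_left h2 (by positivity : (0 : ℝ) ≤ (n : ℝ) ^ 2),
      pow_pos (by linarith : (0 : ℝ) < n) 3]
  calc n * (2 * n + 1) ^ 2 * (q ^ e) ^ (n + d - 1) * (e * q ^ (1 + (e - 1) * d)) * q ^ (e + d)
      = n * (2 * n + 1) ^ 2 * (e * ((q ^ e) ^ (n + d - 1) * q ^ (1 + (e - 1) * d)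
          * q ^ (e + d))) := by ring
    _ ≤ 4.9 * (n ^ 2 * (q ^ 2 * (p : ℝ) ^ n)) * (e * (q ^ (e * (2 * d + n)) * q)) := by
        rw [hexp]
        exact mul_le_mul_of_nonneg_right hnum (by positivity)
    _ = 0.35 * (14 * e * n ^ 2 * (q ^ (e * (2 * d + n) + 3) * (p : ℝ) ^ n)) := by
        rw [pow_add]; ring
    _ = 0.35 * (14 * e * n ^ 2 * Y) * q ^ (e + d) := by rw [← hthr]; ring
    _ ≤ 0.35 * X ^ 2 * q ^ (e + d) := by gcongr

theorem corollary21 {R : Type*} [CommRing R] (p e k d n : ℕ) (hp : p.Prime)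
    (hd : 3 ≤ d) (he : 5 ≤ e) (hk : 1 ≤ k) (hn : 4 ≤ n)
    (hR : IsGaloisRing p e k R) (E : Finset (Fin d → R)) (α : Fin n → R)
    (hE : (E.card : ℝ) > √(14 * (e : ℝ)) * (n : ℝ) *
      (p : ℝ) ^ ((d : ℝ) * e * k - (d : ℝ) * k / 2 + (n : ℝ) * e * k / 2 + (n : ℝ) / 2
        - (e : ℝ) * k / 2 + 3 * (k : ℝ) / 2)) :
    ((starConfigurations E α).ncard : ℝ) ≤ 2 * (E.card : ℝ) ^ (n + 1) / (p : ℝ) ^ (n * e * k) ∧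
    ((stars E α).ncard : ℝ) ≤ 2 * (E.card : ℝ) ^ (n + 1) / (p : ℝ) ^ (n * e * k) := by
  have hchain := hR.isFiniteChainRing hp (by omega)
  have hmain := hchain.ncard_starConfigurations_le (Nat.one_lt_pow (by omega) hp.one_lt)
    (by omega) (by omega) (by omega) E α
  have herr := star_error_le hp (by omega) hk (by omega : 1 ≤ d) hn hE
  have hp0 : (0 : ℝ) < p := by exact_mod_cast hp.pos
  have hbound : ((starConfigurations E α).ncard : ℝ)
      ≤ 2 * (E.card : ℝ) ^ (n + 1) / (p : ℝ) ^ (n * e * k) := by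
    have hQ : (p : ℝ) ^ (n * e * k) = (((p : ℝ) ^ k) ^ e) ^ n := by
      rw [← pow_mul, ← pow_mul]; congr 1; ring
    rw [hQ]
    refine hmain.trans ?_
    push_cast
    set q : ℝ := (p : ℝ) ^ k
    have hq0 : 0 < q := by positivity
    set X : ℝ := (E.card : ℝ)
    have hX0 : 0 ≤ X := Nat.cast_nonneg _
    rw [le_div_iff₀ (by positivity), add_mul]
    -- The constant 2 is split as 1.65 for the main term plus 0.35 for the error.
    have h1 : X * ((1 + 1 / (2 * n)) * (X / q ^ e)) ^ n * (q ^ e) ^ n ≤ 1.65 * X ^ (n + 1) := by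
      have h2 : X * ((1 + 1 / (2 * n)) * (X / q ^ e)) ^ n * (q ^ e) ^ n
          = (1 + 1 / (2 * n)) ^ n * X ^ (n + 1) := by
        rw [mul_pow, div_pow, pow_succ]
        field_simp
      rw [h2]
      exact mul_le_mul_of_nonneg_right (one_add_one_div_two_mul_pow_le n) (by positivity)
    have h3 : n * ((2 * n + 1) ^ 2 * X ^ (n - 1) * (q ^ e) ^ (d - 1)
        * (e * q ^ (1 + (e - 1) * d))) * (q ^ e) ^ n ≤ 0.35 * X ^ (n + 1) := by
      have h4 : n + d - 1 = n + (d - 1) := by omega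
      have h5 : n + 1 = n - 1 + 2 := by omega
      calc _ = X ^ (n - 1) * (n * (2 * n + 1) ^ 2 * (q ^ e) ^ (n + d - 1)
            * (e * q ^ (1 + (e - 1) * d))) := by rw [h4, pow_add (q ^ e)]; ring
        _ ≤ X ^ (n - 1) * (0.35 * X ^ 2) := mul_le_mul_of_nonneg_left herr (by positivity)
        _ = 0.35 * X ^ (n + 1) := by rw [h5, pow_add]; ring
    linarith
  refine ⟨hbound, le_trans (Nat.cast_le.2 ?_) hbound⟩
  exact Set.ncard_le_ncard (fun x hx => hx.1) (starConfigurations_finite E α)
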